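/- Consider the channel $Y = X + Z$ with $Z\sim\mathcal N(0,\sigma^2)$, $\sigma^2>0$, independent of the real input $X$. For $\alpha_1,\alpha_2>0$ and $A>0$ let $$C(\alpha_1,\alpha_2,A)=\sup_{P_X} I(X;Y)\quad\text{(in nats)},$$ where the supremum is over all laws $P_X$ of $X$ such that $X\in[0,A]$ almost surely, $\mathbb E[X]\le \alpha_1 A$ and $\mathbb E[X^2]\le\alpha_2A^2$. Then, for all fixed $\alpha_1,\alpha_2>0$, $$\lim_{A\downarrow 0}\frac{C(\alpha_1,\alpha_2,A)}{A^2}=\frac{1}{2\sigma^2}\,\max_{T}\operatorname{Var}(T),$$ where $T$ ranges over all random variables with $T\in[0,1]$ almost surely, $\mathbb E[T]\le\alpha_1$ and $\mathbb E[T^2]\le\alpha_2$, and the maximum is attained. In particular, for standard noise ($\sigma^2=1$) the limit equals $\tfrac12\max_T\operatorname{Var}(T)$. -/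

import Mathlib

open MeasureTheory ProbabilityTheory Filter Topology
open scoped ENNReal NNReal

noncomputable section

namespace GaussianChannel

/-- Mutual information, in nats, of a pair of random variables with joint law `ρ`: the
Kullback-Leibler divergence of the joint law from the product of its two marginals. -/
def mutualInfo {α β : Type*} [MeasurableSpace α] [MeasurableSpace β]
    (ρ : Measure (α × β)) : ℝ≥0∞ :=
  InformationTheory.klDiv ρ (ρ.fst.prod ρ.snd)

/-- The joint law of `(X, Y)` where `Y = X + Z`, the input `X` has law `μ`, and the noise `Z` is
centred Gaussian with variance `v` and independent of `X`. -/
def inputOutputLaw (v : ℝ≥0) (μ : Measure ℝ) : Measure (ℝ × ℝ) :=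
  (μ.prod (gaussianReal 0 v)).map (fun p => (p.1, p.1 + p.2))

/-- `μ` is the law of a random variable `X` with `X ∈ [0, A]` almost surely,
`E[X] ≤ α₁ A` and `E[X²] ≤ α₂ A²`. -/
structure IsInputLaw (α₁ α₂ A : ℝ) (μ : Measure ℝ) : Prop where
  isProbabilityMeasure : IsProbabilityMeasure μ
  peak : ∀ᵐ x ∂μ, x ∈ Set.Icc 0 A
  first_moment : ∫ x, x ∂μ ≤ α₁ * A
  second_moment : ∫ x, x ^ 2 ∂μ ≤ α₂ * A ^ 2

/-- The capacity, in nats: the supremum of `I(X; X + Z)` over all admissible input laws, for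
Gaussian noise of variance `v`. -/
def capacity (v : ℝ≥0) (α₁ α₂ A : ℝ) : ℝ≥0∞ :=
  ⨆ (μ : Measure ℝ) (_ : IsInputLaw α₁ α₂ A μ), mutualInfo (inputOutputLaw v μ)

/-- The values of `Var(T)` over all random variables `T ∈ [0, 1]` with `E[T] ≤ α₁` and
`E[T²] ≤ α₂` (the input constraints with unit peak), described through their laws `τ`. -/
def normalizedVariances (α₁ α₂ : ℝ) : Set ℝ :=
  {w | ∃ τ : Measure ℝ, IsInputLaw α₁ α₂ 1 τ ∧ w = Var[fun t : ℝ => t; τ]}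

end GaussianChannel

end

/-! ### Output density and likelihood ratio of the channel. -/

namespace GaussianChannel

/-! Let `m` be the input mean, `f` the output density and `φ_m` the Gaussian density centred at `m`.
Inserting `φ_m` into the log-likelihood ratio gives `I(X;Y) = Var(X)/(2v) - D(f ‖ φ_m)`. The
divergence is nonnegative and at most the chi-square quantity `E[exp((X-m)(X'-m)/v)] - 1`, with `X'`
an independent copy of `X`. Since `X - m` is centred, the linear term of the exponential vanishes,
leaving an error of order `A^4`: this is `mutualInfo_inputOutputLaw_bounds`.

Rescaling inputs by `A` turns `Var(X)` into `A^2 Var(T)`, so after division by `A^2` the capacity is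
squeezed between `M/(2v) - A^2/v^2` and `M/(2v)`. The maximum `M` exists because the variance
depends only on two moments, and the attainable pairs form a compact set. -/

/-- The Lebesgue density of the channel output `X + Z` when the input `X` has law `μ`. -/
noncomputable def outputDensity (v : ℝ≥0) (μ : Measure ℝ) (y : ℝ) : ℝ≥0∞ :=
  ∫⁻ x, gaussianPDF x v y ∂μ

@[fun_prop]
lemma measurable_channelDensity (v : ℝ≥0) :
    Measurable (fun p : ℝ × ℝ => gaussianPDF p.1 v p.2) := by
  have h : Measurable (fun p : ℝ × ℝ => (p.1, v, p.2)) := by fun_prop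
  exact measurable_uncurry_gaussianPDF.comp h

@[fun_prop]
lemma measurable_outputDensity (v : ℝ≥0) (μ : Measure ℝ) [SFinite μ] :
    Measurable (outputDensity v μ) :=
  (measurable_channelDensity v).lintegral_prod_left'

lemma outputDensity_ne_zero {v : ℝ≥0} (hv : v ≠ 0) (μ : Measure ℝ) [NeZero μ] (y : ℝ) :
    outputDensity v μ y ≠ 0 := by
  have hm : Measurable (fun x => gaussianPDF x v y) := by
    unfold gaussianPDF gaussianPDFReal
    fun_prop
  intro h
  rw [outputDensity, lintegral_eq_zero_iff hm] at h
  obtain ⟨x, hx⟩ : ∃ x, gaussianPDF x v y = 0 := h.exists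
  exact absurd hx (gaussianPDF_pos x hv y).ne'

lemma outputDensity_ne_top (v : ℝ≥0) (μ : Measure ℝ) [IsFiniteMeasure μ] (y : ℝ) :
    outputDensity v μ y ≠ ∞ := by
  have hle : outputDensity v μ y ≤ ∫⁻ _, ENNReal.ofReal (√(2 * Real.pi * v))⁻¹ ∂μ := by
    refine lintegral_mono fun x => ENNReal.ofReal_le_ofReal ?_
    rw [gaussianPDFReal]
    refine mul_le_of_le_one_right (by positivity) (Real.exp_le_one_iff.2 ?_)
    exact div_nonpos_of_nonpos_of_nonneg (by nlinarith [sq_nonneg (y - x)]) (by positivity)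
  refine ne_top_of_le_ne_top ?_ hle
  rw [lintegral_const]
  exact ENNReal.mul_ne_top ENNReal.ofReal_ne_top (measure_ne_top _ _)

lemma inputOutputLaw_eq_withDensity {v : ℝ≥0} (hv : v ≠ 0) (μ : Measure ℝ) [SFinite μ] :
    inputOutputLaw v μ = (μ.prod volume).withDensity (fun p => gaussianPDF p.1 v p.2) := by
  have hmap : Measurable (fun p : ℝ × ℝ => (p.1, p.1 + p.2)) := by fun_prop
  ext s hs
  rw [inputOutputLaw, Measure.map_apply hmap hs, Measure.prod_apply (hmap hs),
    withDensity_apply _ hs, ← lintegral_indicator hs,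
    lintegral_prod _ ((measurable_channelDensity v).indicator hs).aemeasurable]
  refine lintegral_congr fun x => ?_
  have hsx : MeasurableSet (Prod.mk x ⁻¹' s) := measurable_prodMk_left hs
  have hshift : (gaussianReal 0 v) ((fun z => x + z) ⁻¹' (Prod.mk x ⁻¹' s))
      = gaussianReal x v (Prod.mk x ⁻¹' s) := by
    rw [← Measure.map_apply (by fun_prop) hsx, gaussianReal_map_const_add, zero_add]
  refine hshift.trans ?_
  rw [gaussianReal_apply _ hv, ← lintegral_indicator hsx]
  rfl

instance (v : ℝ≥0) (μ : Measure ℝ) [IsProbabilityMeasure μ] :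
    IsProbabilityMeasure (inputOutputLaw v μ) :=
  Measure.isProbabilityMeasure_map (by fun_prop)

lemma fst_inputOutputLaw (v : ℝ≥0) (μ : Measure ℝ) [SFinite μ] :
    (inputOutputLaw v μ).fst = μ := by
  rw [inputOutputLaw, Measure.fst, Measure.map_map (by fun_prop) (by fun_prop)]
  exact Measure.fst_prod

lemma snd_inputOutputLaw {v : ℝ≥0} (hv : v ≠ 0) (μ : Measure ℝ) [SFinite μ] :
    (inputOutputLaw v μ).snd = volume.withDensity (outputDensity v μ) := by
  ext s hs
  have hs' : MeasurableSet (Prod.snd ⁻¹' s : Set (ℝ × ℝ)) := measurable_snd hs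
  rw [Measure.snd_apply hs, inputOutputLaw_eq_withDensity hv, withDensity_apply _ hs',
    ← lintegral_indicator hs',
    lintegral_prod_symm _ ((measurable_channelDensity v).indicator hs').aemeasurable,
    withDensity_apply _ hs, ← lintegral_indicator hs]
  refine lintegral_congr fun y => ?_
  by_cases hy : y ∈ s <;> simp [hy, outputDensity, Set.indicator]

lemma inputOutputLaw_eq_withDensity_prod {v : ℝ≥0} (hv : v ≠ 0) (μ : Measure ℝ)
    [IsProbabilityMeasure μ] :
    inputOutputLaw v μ = ((inputOutputLaw v μ).fst.prod (inputOutputLaw v μ).snd).withDensity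
      (fun p => gaussianPDF p.1 v p.2 / outputDensity v μ p.2) := by
  rw [fst_inputOutputLaw, snd_inputOutputLaw hv, prod_withDensity_right (by fun_prop),
    ← withDensity_mul _ (by fun_prop) (by fun_prop), inputOutputLaw_eq_withDensity hv]
  congr 1
  ext p
  exact (ENNReal.mul_div_cancel (outputDensity_ne_zero hv μ _)
    (outputDensity_ne_top v μ _)).symm

lemma llr_inputOutputLaw {v : ℝ≥0} (hv : v ≠ 0) (μ : Measure ℝ) [IsProbabilityMeasure μ] :
    llr (inputOutputLaw v μ) ((inputOutputLaw v μ).fst.prod (inputOutputLaw v μ).snd)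
      =ᵐ[inputOutputLaw v μ]
        fun p => Real.log (gaussianPDFReal p.1 v p.2 / (outputDensity v μ p.2).toReal) := by
  have hm : Measurable (fun p : ℝ × ℝ => gaussianPDF p.1 v p.2 / outputDensity v μ p.2) := by
    fun_prop
  have h := Measure.rnDeriv_withDensity
    ((inputOutputLaw v μ).fst.prod (inputOutputLaw v μ).snd) hm
  rw [← inputOutputLaw_eq_withDensity_prod hv μ] at h
  have hac : inputOutputLaw v μ ≪ (inputOutputLaw v μ).fst.prod (inputOutputLaw v μ).snd := by
    conv_lhs => rw [inputOutputLaw_eq_withDensity_prod hv μ]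
    exact withDensity_absolutelyContinuous _ _
  filter_upwards [hac.ae_le h] with p hp
  rw [llr, hp, ENNReal.toReal_div, toReal_gaussianPDF]

lemma lintegral_inputOutputLaw {v : ℝ≥0} (hv : v ≠ 0) (μ : Measure ℝ) [SFinite μ]
    {g : ℝ × ℝ → ℝ≥0∞} (hg : Measurable g) :
    ∫⁻ p, g p ∂(inputOutputLaw v μ) = ∫⁻ x, ∫⁻ y, gaussianPDF x v y * g (x, y) ∂volume ∂μ := by
  rw [inputOutputLaw_eq_withDensity hv, lintegral_withDensity_eq_lintegral_mul _ (by fun_prop) hg,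
    lintegral_prod _ (by fun_prop)]
  rfl

/-! ### Gaussian density ratios and their means. -/

lemma log_gaussianPDFReal_div {v : ℝ≥0} (hv : v ≠ 0) (x m y : ℝ) :
    Real.log (gaussianPDFReal x v y / gaussianPDFReal m v y)
      = (x - m) ^ 2 / (2 * v) + (x - m) * (y - x) / v := by
  have hv' : (v : ℝ) ≠ 0 := by exact_mod_cast hv
  have hc : (√(2 * Real.pi * v))⁻¹ ≠ 0 := by positivity
  rw [gaussianPDFReal, gaussianPDFReal, mul_div_mul_left _ _ hc, ← Real.exp_sub, Real.log_exp]
  field_simp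
  ring

/-- Completing the square: the quotient of three Gaussians of equal variance is again a multiple of
a Gaussian, which makes the chi-square integral explicit. -/
lemma gaussianPDFReal_mul_div {v : ℝ≥0} (hv : v ≠ 0) (x x' m y : ℝ) :
    gaussianPDFReal x v y * (gaussianPDFReal x' v y / gaussianPDFReal m v y)
      = Real.exp ((x - m) * (x' - m) / v) * gaussianPDFReal (x + x' - m) v y := by
  have hv' : (v : ℝ) ≠ 0 := by exact_mod_cast hv
  have hc : (√(2 * Real.pi * v))⁻¹ ≠ 0 := by positivity
  simp only [gaussianPDFReal]
  rw [mul_div_mul_left _ _ hc, ← Real.exp_sub, mul_assoc, mul_left_comm (Real.exp _),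
    ← Real.exp_add, ← Real.exp_add]
  congr 2
  field_simp
  ring

lemma lintegral_gaussianPDF_mul_div {v : ℝ≥0} (hv : v ≠ 0) (x x' m : ℝ) :
    ∫⁻ y, gaussianPDF x v y * (gaussianPDF x' v y / gaussianPDF m v y)
      = ENNReal.ofReal (Real.exp ((x - m) * (x' - m) / v)) := by
  have h (y : ℝ) : gaussianPDF x v y * (gaussianPDF x' v y / gaussianPDF m v y)
      = ENNReal.ofReal (Real.exp ((x - m) * (x' - m) / v)) * gaussianPDF (x + x' - m) v y := by
    simp only [gaussianPDF]
    rw [← ENNReal.ofReal_div_of_pos (gaussianPDFReal_pos m v y hv),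
      ← ENNReal.ofReal_mul (gaussianPDFReal_nonneg _ _ _), gaussianPDFReal_mul_div hv,
      ENNReal.ofReal_mul (Real.exp_pos _).le]
  simp_rw [h]
  rw [lintegral_const_mul _ (measurable_gaussianPDF _ _), lintegral_gaussianPDF_eq_one _ hv,
    mul_one]

/-- The output density cancels, leaving the total mass of a Gaussian. This yields `D(f ‖ φ_m) ≥ 0`,
hence the upper bound on the information. -/
lemma lintegral_gaussianPDF_div_outputDensity {v : ℝ≥0} (hv : v ≠ 0) (μ : Measure ℝ)
    [IsProbabilityMeasure μ] (m : ℝ) :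
    ∫⁻ p, gaussianPDF m v p.2 / outputDensity v μ p.2 ∂(inputOutputLaw v μ) = 1 := by
  have hm : Measurable (fun y => gaussianPDF m v y / outputDensity v μ y) :=
    (measurable_gaussianPDF m v).div (measurable_outputDensity v μ)
  have hsnd : ∫⁻ p, gaussianPDF m v p.2 / outputDensity v μ p.2 ∂(inputOutputLaw v μ)
      = ∫⁻ y, gaussianPDF m v y / outputDensity v μ y ∂(inputOutputLaw v μ).snd := by
    rw [Measure.snd, lintegral_map hm measurable_snd]
  rw [hsnd, snd_inputOutputLaw hv, lintegral_withDensity_eq_lintegral_mul _ (by fun_prop) hm,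
    ← lintegral_gaussianPDF_eq_one m hv]
  exact lintegral_congr fun y =>
    ENNReal.mul_div_cancel (outputDensity_ne_zero hv μ _) (outputDensity_ne_top v μ _)

/-- Writing the density in the numerator as a mixture introduces the independent copy of the input;
the integral over `y` is then explicit. -/
lemma lintegral_outputDensity_div_gaussianPDF {v : ℝ≥0} (hv : v ≠ 0) (μ : Measure ℝ)
    [IsProbabilityMeasure μ] (m : ℝ) :
    ∫⁻ p, outputDensity v μ p.2 / gaussianPDF m v p.2 ∂(inputOutputLaw v μ)
      = ∫⁻ p, ENNReal.ofReal (Real.exp ((p.1 - m) * (p.2 - m) / v)) ∂(μ.prod μ) := by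
  have hq : Measurable (gaussianPDF m v) := measurable_gaussianPDF m v
  rw [lintegral_inputOutputLaw hv μ (by fun_prop), lintegral_prod _ (by fun_prop)]
  refine lintegral_congr fun x => ?_
  have hx : Measurable (gaussianPDF x v) := measurable_gaussianPDF x v
  have hF : ∀ y, gaussianPDF x v y * (outputDensity v μ y / gaussianPDF m v y)
      = ∫⁻ x', gaussianPDF x v y * (gaussianPDF x' v y / gaussianPDF m v y) ∂μ := by
    intro y
    have hy : Measurable (fun x' => gaussianPDF x' v y) := by
      unfold gaussianPDF gaussianPDFReal
      fun_prop
    simp_rw [div_eq_mul_inv]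
    rw [lintegral_const_mul _ (hy.mul_const _), lintegral_mul_const _ hy, outputDensity]
  simp_rw [hF]
  have hj : Measurable (fun p : ℝ × ℝ =>
      gaussianPDF x v p.1 * (gaussianPDF p.2 v p.1 / gaussianPDF m v p.1)) := by
    have h := (measurable_channelDensity v).comp measurable_swap
    exact (hx.comp measurable_fst).mul (h.div (hq.comp measurable_fst))
  rw [lintegral_lintegral_swap hj.aemeasurable]
  simp_rw [lintegral_gaussianPDF_mul_div hv]

/-! ### Mutual information of short-range inputs. -/

section Centred

variable {v : ℝ≥0} {μ : Measure ℝ} [IsProbabilityMeasure μ] {A : ℝ}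

lemma mean_mem_Icc_of_peak (hμ : ∀ᵐ x ∂μ, x ∈ Set.Icc 0 A) :
    ∫ x, x ∂μ ∈ Set.Icc 0 A :=
  (convex_Icc 0 A).integral_mem isClosed_Icc hμ
    ((memLp_of_bounded hμ (by fun_prop) 1).integrable le_rfl)

lemma abs_sub_mean_le (hμ : ∀ᵐ x ∂μ, x ∈ Set.Icc 0 A) :
    ∀ᵐ x ∂μ, |x - ∫ t, t ∂μ| ≤ A := by
  have hm := mean_mem_Icc_of_peak hμ
  filter_upwards [hμ] with x hx
  rw [abs_le]
  constructor <;> linarith [hx.1, hx.2, hm.1, hm.2]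

lemma integral_exp_centred_le (hv : v ≠ 0) (hμ : ∀ᵐ x ∂μ, x ∈ Set.Icc 0 A) (hA : A ^ 2 ≤ v) :
    Integrable (fun p : ℝ × ℝ =>
        Real.exp ((p.1 - ∫ t, t ∂μ) * (p.2 - ∫ t, t ∂μ) / v)) (μ.prod μ) ∧
      ∫ p, Real.exp ((p.1 - ∫ t, t ∂μ) * (p.2 - ∫ t, t ∂μ) / v) ∂(μ.prod μ)
        ≤ 1 + A ^ 4 / v ^ 2 := by
  have hv' : (0 : ℝ) < v := by positivity
  have hid : Integrable (fun x : ℝ => x) μ :=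
    (memLp_of_bounded hμ (by fun_prop) 1).integrable le_rfl
  set m := ∫ t, t ∂μ with hmdef
  have hu : Integrable (fun x : ℝ => x - m) μ := hid.sub (integrable_const _)
  have hu0 : ∫ x, (x - m) ∂μ = 0 := by
    rw [integral_sub hid (integrable_const _)]
    simp [hmdef]
  have hb := abs_sub_mean_le hμ
  have hb1 : ∀ᵐ p ∂(μ.prod μ), |p.1 - m| ≤ A := Measure.quasiMeasurePreserving_fst.ae hb
  have hb2 : ∀ᵐ p ∂(μ.prod μ), |p.2 - m| ≤ A := Measure.quasiMeasurePreserving_snd.ae hb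
  have ht : ∀ᵐ p ∂(μ.prod μ), |(p.1 - m) * (p.2 - m) / v| ≤ A ^ 2 / v := by
    filter_upwards [hb1, hb2] with p h1 h2
    rw [abs_div, abs_mul, abs_of_pos hv', pow_two]
    gcongr
    exact (abs_nonneg _).trans h1
  have hA1 : A ^ 2 / v ≤ 1 := (div_le_one hv').2 hA
  have hlin : Integrable (fun p : ℝ × ℝ => (p.1 - m) * (p.2 - m) / v) (μ.prod μ) :=
    (hu.mul_prod hu).div_const _
  have hub : ∀ᵐ p ∂(μ.prod μ), Real.exp ((p.1 - m) * (p.2 - m) / v)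
      ≤ (1 + A ^ 4 / v ^ 2) + (p.1 - m) * (p.2 - m) / v := by
    -- `A ^ 2 ≤ v` keeps the exponent in `[-1, 1]`, where `|exp t - 1 - t| ≤ t ^ 2`. The linear term
    -- is kept because it integrates to zero.
    filter_upwards [ht] with p hp
    have h1 := (abs_le.1 (Real.abs_exp_sub_one_sub_id_le (hp.trans hA1))).2
    have h2 : ((p.1 - m) * (p.2 - m) / v) ^ 2 ≤ (A ^ 2 / v) ^ 2 :=
      sq_le_sq' (abs_le.1 hp).1 (abs_le.1 hp).2
    have h3 : (A ^ 2 / v) ^ 2 = A ^ 4 / (v : ℝ) ^ 2 := by ring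
    linarith
  have hmaj : Integrable (fun p : ℝ × ℝ => (1 + A ^ 4 / v ^ 2) + (p.1 - m) * (p.2 - m) / v)
      (μ.prod μ) := (integrable_const _).add hlin
  have hint : Integrable (fun p : ℝ × ℝ => Real.exp ((p.1 - m) * (p.2 - m) / v)) (μ.prod μ) :=
    integrable_of_le_of_le (by fun_prop) (ae_of_all _ fun _ => (Real.exp_pos _).le) hub
      (integrable_zero _ _ _) hmaj
  refine ⟨hint, (integral_mono_ae hint hmaj hub).trans_eq ?_⟩
  rw [integral_add (integrable_const _) hlin, integral_div,
    integral_prod_mul (fun x => x - m) (fun x => x - m), hu0]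
  simp

/-- In terms of `X` and `Z` the logarithm is `(X-m)^2/(2v) + (X-m)Z/v`, and the cross term has mean
zero by independence. -/
lemma integral_log_gaussianPDFReal_div (hv : v ≠ 0) (hμ : ∀ᵐ x ∂μ, x ∈ Set.Icc 0 A) :
    Integrable (fun p : ℝ × ℝ =>
        Real.log (gaussianPDFReal p.1 v p.2 / gaussianPDFReal (∫ t, t ∂μ) v p.2))
        (inputOutputLaw v μ) ∧
      ∫ p, Real.log (gaussianPDFReal p.1 v p.2 / gaussianPDFReal (∫ t, t ∂μ) v p.2)
        ∂(inputOutputLaw v μ) = Var[fun x : ℝ => x; μ] / (2 * v) := by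
  simp_rw [log_gaussianPDFReal_div hv]
  have hL2 := memLp_of_bounded hμ (f := fun x : ℝ => x) (by fun_prop) 2
  have hid : Integrable (fun x : ℝ => x) μ := hL2.integrable (by norm_num)
  set m := ∫ t, t ∂μ with hmdef
  have hu : Integrable (fun x : ℝ => x - m) μ := hid.sub (integrable_const _)
  have hu2 : Integrable (fun x : ℝ => (x - m) ^ 2) μ :=
    (hL2.sub (memLp_const m)).integrable_sq
  have hz : Integrable (fun z : ℝ => z) (gaussianReal 0 v) :=
    (memLp_id_gaussianReal' 1 (by simp)).integrable le_rfl
  have hmap : Measurable (fun p : ℝ × ℝ => (p.1, p.1 + p.2)) := by fun_prop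
  have hg : Measurable (fun p : ℝ × ℝ =>
      (p.1 - m) ^ 2 / (2 * v) + (p.1 - m) * (p.2 - p.1) / v) := by fun_prop
  have h1 : Integrable (fun p : ℝ × ℝ => (p.1 - m) ^ 2 / (2 * v))
      (μ.prod (gaussianReal 0 v)) := (hu2.comp_fst (gaussianReal 0 v)).div_const _
  have h2 : Integrable (fun p : ℝ × ℝ => (p.1 - m) * p.2 / v) (μ.prod (gaussianReal 0 v)) :=
    (hu.mul_prod hz).div_const _
  rw [inputOutputLaw, integrable_map_measure hg.aestronglyMeasurable hmap.aemeasurable,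
    integral_map hmap.aemeasurable hg.aestronglyMeasurable]
  simp only [Function.comp_def, add_sub_cancel_left]
  refine ⟨h1.add h2, ?_⟩
  rw [integral_add h1 h2, integral_div, integral_div,
    integral_prod_mul (fun x => x - m) (fun z => z), integral_id_gaussianReal,
    integral_fun_fst (fun x => (x - m) ^ 2), variance_eq_integral (by fun_prop)]
  simp [hmdef]

/-- For inputs confined to a short interval, the mutual information is the input variance over
twice the noise variance, up to a term of fourth order. -/
theorem mutualInfo_inputOutputLaw_bounds (hv : v ≠ 0) (hμ : ∀ᵐ x ∂μ, x ∈ Set.Icc 0 A)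
    (hA : A ^ 2 ≤ v) :
    ENNReal.ofReal (Var[fun x : ℝ => x; μ] / (2 * v) - A ^ 4 / v ^ 2)
        ≤ mutualInfo (inputOutputLaw v μ) ∧
      mutualInfo (inputOutputLaw v μ) ≤ ENNReal.ofReal (Var[fun x : ℝ => x; μ] / (2 * v)) := by
  set m := ∫ t, t ∂μ with hm
  set ρ := inputOutputLaw v μ with hρ
  obtain ⟨hgint, hgval⟩ := integral_log_gaussianPDFReal_div (v := v) hv hμ
  obtain ⟨heint, heval⟩ := integral_exp_centred_le hv hμ hA
  rw [← hm, ← hρ] at hgint hgval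
  rw [← hm] at heint heval
  have hq : Measurable (gaussianPDF m v) := measurable_gaussianPDF m v
  -- the two density ratios
  have hm1 : Measurable (fun p : ℝ × ℝ => gaussianPDF m v p.2 / outputDensity v μ p.2) := by
    fun_prop
  have hm2 : Measurable (fun p : ℝ × ℝ => outputDensity v μ p.2 / gaussianPDF m v p.2) := by
    fun_prop
  have hl1 := lintegral_gaussianPDF_div_outputDensity hv μ m
  have hl2 : ∫⁻ p, outputDensity v μ p.2 / gaussianPDF m v p.2 ∂ρ
      = ENNReal.ofReal (∫ p, Real.exp ((p.1 - m) * (p.2 - m) / v) ∂(μ.prod μ)) := by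
    rw [hρ, lintegral_outputDensity_div_gaussianPDF hv μ m,
      ofReal_integral_eq_lintegral_ofReal heint (ae_of_all _ fun _ => (Real.exp_pos _).le)]
  have hi1 := integrable_toReal_of_lintegral_ne_top hm1.aemeasurable (hl1.trans_ne (by simp))
  have hi2 := integrable_toReal_of_lintegral_ne_top hm2.aemeasurable (hl2.trans_ne (by simp))
  have hv1 : ∫ p, (gaussianPDF m v p.2 / outputDensity v μ p.2).toReal ∂ρ = 1 := by
    rw [integral_toReal hm1.aemeasurable (ae_lt_top hm1 (hl1.trans_ne (by simp))), hl1,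
      ENNReal.toReal_one]
  have hv2 : ∫ p, (outputDensity v μ p.2 / gaussianPDF m v p.2).toReal ∂ρ
      ≤ 1 + A ^ 4 / v ^ 2 := by
    rw [integral_toReal hm2.aemeasurable (ae_lt_top hm2 (hl2.trans_ne (by simp))), hl2,
      ENNReal.toReal_ofReal (integral_nonneg fun _ => (Real.exp_pos _).le)]
    exact heval
  rw [← hρ] at hi1
  -- pointwise comparison of the log-likelihood ratio with integrable functions
  have key (p : ℝ × ℝ) :
      Real.log (gaussianPDFReal p.1 v p.2 / gaussianPDFReal m v p.2)
          + (1 - (outputDensity v μ p.2 / gaussianPDF m v p.2).toReal)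
        ≤ Real.log (gaussianPDFReal p.1 v p.2 / (outputDensity v μ p.2).toReal) ∧
      Real.log (gaussianPDFReal p.1 v p.2 / (outputDensity v μ p.2).toReal)
        ≤ Real.log (gaussianPDFReal p.1 v p.2 / gaussianPDFReal m v p.2)
          + ((gaussianPDF m v p.2 / outputDensity v μ p.2).toReal - 1) := by
    have hφ := gaussianPDFReal_pos p.1 v p.2 hv
    have hψ := gaussianPDFReal_pos m v p.2 hv
    have hf : 0 < (outputDensity v μ p.2).toReal :=
      ENNReal.toReal_pos (outputDensity_ne_zero hv μ _) (outputDensity_ne_top v μ _)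
    -- `log t ≤ t - 1` is used for `f/φ_m` and for its inverse, bounding `log (f/φ_m)` on both
    -- sides.
    have ha := Real.log_le_sub_one_of_pos (div_pos hf hψ)
    have hb := Real.log_le_sub_one_of_pos (div_pos hψ hf)
    rw [ENNReal.toReal_div, ENNReal.toReal_div, toReal_gaussianPDF]
    rw [Real.log_div hf.ne' hψ.ne'] at ha
    rw [Real.log_div hψ.ne' hf.ne'] at hb
    rw [Real.log_div hφ.ne' hψ.ne', Real.log_div hφ.ne' hf.ne']
    constructor <;> linarith
  have hllr := llr_inputOutputLaw hv μ
  rw [← hρ] at hllr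
  have hs2 : Integrable (fun p => 1 - (outputDensity v μ p.2 / gaussianPDF m v p.2).toReal) ρ :=
    (integrable_const (1 : ℝ)).sub hi2
  have hs1 : Integrable (fun p => (gaussianPDF m v p.2 / outputDensity v μ p.2).toReal - 1) ρ :=
    hi1.sub (integrable_const (1 : ℝ))
  have hlo := hgint.add hs2
  have hhi := hgint.add hs1
  have hlo_le : (fun p => Real.log (gaussianPDFReal p.1 v p.2 / gaussianPDFReal m v p.2)
      + (1 - (outputDensity v μ p.2 / gaussianPDF m v p.2).toReal)) ≤ᵐ[ρ]
      llr ρ (ρ.fst.prod ρ.snd) := by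
    filter_upwards [hllr] with p hp
    rw [hp]
    exact (key p).1
  have hle_hi : llr ρ (ρ.fst.prod ρ.snd) ≤ᵐ[ρ]
      fun p => Real.log (gaussianPDFReal p.1 v p.2 / gaussianPDFReal m v p.2)
      + ((gaussianPDF m v p.2 / outputDensity v μ p.2).toReal - 1) := by
    filter_upwards [hllr] with p hp
    rw [hp]
    exact (key p).2
  have hint : Integrable (llr ρ (ρ.fst.prod ρ.snd)) ρ :=
    integrable_of_le_of_le (measurable_llr _ _).aestronglyMeasurable hlo_le hle_hi hlo hhi
  have hac : ρ ≪ ρ.fst.prod ρ.snd := by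
    conv_lhs => rw [hρ, inputOutputLaw_eq_withDensity_prod hv μ]
    exact withDensity_absolutelyContinuous _ _
  have hmi : mutualInfo ρ = ENNReal.ofReal (∫ p, llr ρ (ρ.fst.prod ρ.snd) p ∂ρ) := by
    rw [mutualInfo, InformationTheory.klDiv_of_ac_of_integrable hac hint]
    simp
  have hone : ∫ _, (1 : ℝ) ∂ρ = 1 := by simp
  have hIlo := integral_mono_ae hlo hint hlo_le
  have hIhi := integral_mono_ae hint hhi hle_hi
  simp only [Pi.add_apply] at hIlo hIhi
  rw [integral_add hgint hs2,
    integral_sub (integrable_const (1 : ℝ)) hi2, hgval, hone] at hIlo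
  rw [integral_add hgint hs1,
    integral_sub hi1 (integrable_const (1 : ℝ)), hgval, hone, hv1] at hIhi
  rw [hmi]
  exact ⟨ENNReal.ofReal_le_ofReal (by linarith), ENNReal.ofReal_le_ofReal (by linarith)⟩

end Centred

/-! ### Scaling of input laws. -/

lemma IsInputLaw.variance_eq {α₁ α₂ A : ℝ} {μ : Measure ℝ} (h : IsInputLaw α₁ α₂ A μ) :
    Var[fun x : ℝ => x; μ] = ∫ x, x ^ 2 ∂μ - (∫ x, x ∂μ) ^ 2 := by
  have := h.isProbabilityMeasure
  exact variance_eq_sub (memLp_of_bounded h.peak (by fun_prop) 2)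

lemma IsInputLaw.map_const_mul {α₁ α₂ A c : ℝ} {μ : Measure ℝ} (h : IsInputLaw α₁ α₂ A μ)
    (hc : 0 ≤ c) : IsInputLaw α₁ α₂ (c * A) (μ.map (fun x => c * x)) := by
  have := h.isProbabilityMeasure
  refine ⟨Measure.isProbabilityMeasure_map (by fun_prop), ?_, ?_, ?_⟩
  · refine (ae_map_iff (by fun_prop) measurableSet_Icc).2 ?_
    filter_upwards [h.peak] with x hx
    exact ⟨mul_nonneg hc hx.1, mul_le_mul_of_nonneg_left hx.2 hc⟩
  · rw [integral_map (by fun_prop) (by fun_prop), integral_const_mul]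
    nlinarith [mul_le_mul_of_nonneg_left h.first_moment hc]
  · rw [integral_map (by fun_prop) (by fun_prop)]
    simp_rw [mul_pow]
    rw [integral_const_mul]
    nlinarith [mul_le_mul_of_nonneg_left h.second_moment (sq_nonneg c)]

lemma variance_map_const_mul (c : ℝ) (μ : Measure ℝ) :
    Var[fun x : ℝ => x; μ.map (fun x => c * x)] = c ^ 2 * Var[fun x : ℝ => x; μ] := by
  rw [variance_map (by fun_prop) (by fun_prop), ← variance_const_mul]
  rfl

/-! ### Attainable moments and the maximal variance. -/

/-- The law giving mass `p` to `c` and mass `1 - p` to `0`. -/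
noncomputable def onOffLaw (p c : ℝ) : Measure ℝ :=
  ENNReal.ofReal (1 - p) • Measure.dirac 0 + ENNReal.ofReal p • Measure.dirac c

lemma isProbabilityMeasure_onOffLaw {p : ℝ} (hp : p ∈ Set.Icc 0 1) (c : ℝ) :
    IsProbabilityMeasure (onOffLaw p c) := by
  refine ⟨?_⟩
  simp [onOffLaw, ← ENNReal.ofReal_add (sub_nonneg.2 hp.2) hp.1]

lemma integral_onOffLaw {p : ℝ} (hp : p ∈ Set.Icc 0 1) (c : ℝ) (f : ℝ → ℝ) :
    ∫ x, f x ∂(onOffLaw p c) = (1 - p) * f 0 + p * f c := by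
  have hi (a : ℝ) : Integrable f (Measure.dirac a) := integrable_dirac (by simp)
  rw [onOffLaw, integral_add_measure ((hi 0).smul_measure ENNReal.ofReal_ne_top)
    ((hi c).smul_measure ENNReal.ofReal_ne_top), integral_smul_measure, integral_smul_measure,
    integral_dirac, integral_dirac, ENNReal.toReal_ofReal (sub_nonneg.2 hp.2),
    ENNReal.toReal_ofReal hp.1]
  rfl

/-- The pairs of first and second moments attained by laws on the unit interval with first moment
at most `α₁` and second moment at most `α₂`. -/
def momentRegion (α₁ α₂ : ℝ) : Set (ℝ × ℝ) :=
  {z | 0 ≤ z.1 ∧ z.1 ≤ α₁ ∧ z.1 ^ 2 ≤ z.2 ∧ z.2 ≤ z.1 ∧ z.2 ≤ α₂}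

lemma isCompact_momentRegion (α₁ α₂ : ℝ) : IsCompact (momentRegion α₁ α₂) := by
  have hclosed : IsClosed (momentRegion α₁ α₂) :=
    (isClosed_le continuous_const continuous_fst).inter <|
      (isClosed_le continuous_fst continuous_const).inter <|
      (isClosed_le (continuous_fst.pow 2) continuous_snd).inter <|
      (isClosed_le continuous_snd continuous_fst).inter
      (isClosed_le continuous_snd continuous_const)
  refine (isCompact_Icc (a := ((0 : ℝ), (0 : ℝ))) (b := ((1 : ℝ), (1 : ℝ)))).of_isClosed_subset
    hclosed ?_
  rintro ⟨m, q⟩ ⟨h0, -, h2, h3, -⟩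
  simp only at h0 h2 h3
  -- From `m ^ 2 ≤ q ≤ m`.
  have hm : m ≤ 1 := by nlinarith
  exact ⟨⟨h0, (sq_nonneg m).trans h2⟩, ⟨hm, h3.trans hm⟩⟩

lemma IsInputLaw.moments_mem {α₁ α₂ : ℝ} {τ : Measure ℝ} (h : IsInputLaw α₁ α₂ 1 τ) :
    (∫ x, x ∂τ, ∫ x, x ^ 2 ∂τ) ∈ momentRegion α₁ α₂ := by
  have := h.isProbabilityMeasure
  have hL2 := memLp_of_bounded h.peak (f := fun x : ℝ => x) (by fun_prop) 2
  refine ⟨(mean_mem_Icc_of_peak h.peak).1, by simpa using h.first_moment, ?_, ?_,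
    by simpa using h.second_moment⟩
  · have := variance_nonneg (fun x : ℝ => x) τ
    rw [h.variance_eq] at this
    simpa using this
  · refine integral_mono_ae hL2.integrable_sq (hL2.integrable (by norm_num)) ?_
    filter_upwards [h.peak] with x hx
    exact pow_le_of_le_one hx.1 hx.2 two_ne_zero

lemma exists_isInputLaw_of_mem {α₁ α₂ : ℝ} {z : ℝ × ℝ} (hz : z ∈ momentRegion α₁ α₂) :
    ∃ τ, IsInputLaw α₁ α₂ 1 τ ∧ Var[fun x : ℝ => x; τ] = z.2 - z.1 ^ 2 := by
  obtain ⟨m, q⟩ := z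
  obtain ⟨h0, h1, h2, h3, h4⟩ := hz
  simp only at h0 h1 h2 h3 h4
  obtain ⟨p, c, hp, hc, hm, hq⟩ : ∃ p c : ℝ, p ∈ Set.Icc 0 1 ∧ c ∈ Set.Icc 0 1 ∧
      p * c = m ∧ p * c ^ 2 = q := by
    -- Solving `p c = m`, `p c ^ 2 = q` gives `c = q / m`, `p = m ^ 2 / q`; if `m = 0` then `q = 0`
    -- as well.
    rcases h0.eq_or_lt with rfl | hpos
    · exact ⟨0, 0, by simp, by simp, by simp, by simp; nlinarith⟩
    · have hqpos : 0 < q := by nlinarith [pow_pos hpos 2]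
      refine ⟨m ^ 2 / q, q / m, ⟨by positivity, (div_le_one hqpos).2 h2⟩,
        ⟨by positivity, (div_le_one hpos).2 h3⟩, ?_, ?_⟩ <;> field_simp
  have hprob := isProbabilityMeasure_onOffLaw hp c
  have hm' : ∫ x, x ∂(onOffLaw p c) = m := by
    rw [integral_onOffLaw hp c (fun x => x)]
    linarith
  have hq' : ∫ x, x ^ 2 ∂(onOffLaw p c) = q := by
    rw [integral_onOffLaw hp c (fun x => x ^ 2)]
    linarith
  have hlaw : IsInputLaw α₁ α₂ 1 (onOffLaw p c) := by
    refine ⟨hprob, ?_, by rw [hm']; linarith, by rw [hq']; linarith⟩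
    rw [onOffLaw, ae_add_measure_iff]
    refine ⟨Measure.ae_smul_measure ?_ _, Measure.ae_smul_measure ?_ _⟩
    · exact (ae_dirac_iff measurableSet_Icc).2 (by simp)
    · exact (ae_dirac_iff measurableSet_Icc).2 hc
  exact ⟨_, hlaw, by rw [hlaw.variance_eq, hm', hq']⟩

lemma exists_isGreatest_normalizedVariances {α₁ α₂ : ℝ} (hα₁ : 0 < α₁) (hα₂ : 0 < α₂) :
    ∃ M, IsGreatest (normalizedVariances α₁ α₂) M := by
  have hne : (momentRegion α₁ α₂).Nonempty :=
    ⟨(0, 0), by simp [momentRegion, hα₁.le, hα₂.le]⟩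
  obtain ⟨z, hz, hmax⟩ := (isCompact_momentRegion α₁ α₂).exists_isMaxOn hne
    (f := fun z => z.2 - z.1 ^ 2) (by fun_prop)
  obtain ⟨τ, hτ, hvar⟩ := exists_isInputLaw_of_mem hz
  refine ⟨z.2 - z.1 ^ 2, ⟨τ, hτ, hvar.symm⟩, ?_⟩
  rintro _ ⟨τ', hτ', rfl⟩
  rw [hτ'.variance_eq]
  exact hmax hτ'.moments_mem

/-! ### Capacity bounds and the limit. -/

variable {v : ℝ≥0} {α₁ α₂ A M : ℝ}

lemma capacity_le (hv : v ≠ 0) (hA : 0 < A) (hAv : A ^ 2 ≤ v)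
    (hM : M ∈ upperBounds (normalizedVariances α₁ α₂)) :
    capacity v α₁ α₂ A ≤ ENNReal.ofReal (M / (2 * v)) * ENNReal.ofReal (A ^ 2) := by
  refine iSup₂_le fun μ hμ => ?_
  have := hμ.isProbabilityMeasure
  refine (mutualInfo_inputOutputLaw_bounds hv hμ.peak hAv).2.trans ?_
  rw [← ENNReal.ofReal_mul' (sq_nonneg A)]
  refine ENNReal.ofReal_le_ofReal ?_
  have hscale := hμ.map_const_mul (inv_nonneg.2 hA.le)
  rw [inv_mul_cancel₀ hA.ne'] at hscale
  have hvar := hM ⟨_, hscale, rfl⟩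
  rw [variance_map_const_mul, inv_pow, inv_mul_le_iff₀ (by positivity)] at hvar
  calc Var[fun x : ℝ => x; μ] / (2 * v) ≤ A ^ 2 * M / (2 * v) := by gcongr
    _ = M / (2 * v) * A ^ 2 := by ring

lemma le_capacity (hv : v ≠ 0) (hA : 0 < A) (hAv : A ^ 2 ≤ v)
    (hM : M ∈ normalizedVariances α₁ α₂) :
    ENNReal.ofReal (M / (2 * v) - A ^ 2 / v ^ 2) * ENNReal.ofReal (A ^ 2)
      ≤ capacity v α₁ α₂ A := by
  obtain ⟨τ, hτ, rfl⟩ := hM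
  have hμ := hτ.map_const_mul hA.le
  rw [mul_one] at hμ
  have := hμ.isProbabilityMeasure
  refine le_trans ?_ ((mutualInfo_inputOutputLaw_bounds hv hμ.peak hAv).1.trans
    (le_iSup₂_of_le (f := fun μ (_ : IsInputLaw α₁ α₂ A μ) => mutualInfo (inputOutputLaw v μ))
      _ hμ le_rfl))
  rw [← ENNReal.ofReal_mul' (sq_nonneg A), variance_map_const_mul]
  exact ENNReal.ofReal_le_ofReal (le_of_eq (by ring))

end GaussianChannel

theorem mainTheorem2 (v : ℝ≥0) (hv : 0 < v) (α₁ α₂ : ℝ) (hα₁ : 0 < α₁) (hα₂ : 0 < α₂) :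
    ∃ M : ℝ, IsGreatest (GaussianChannel.normalizedVariances α₁ α₂) M ∧
      Tendsto (fun A : ℝ => GaussianChannel.capacity v α₁ α₂ A / ENNReal.ofReal (A ^ 2))
        (𝓝[>] 0) (𝓝 (ENNReal.ofReal (M / (2 * (v : ℝ))))) := by
  obtain ⟨M, hM⟩ := GaussianChannel.exists_isGreatest_normalizedVariances hα₁ hα₂
  refine ⟨M, hM, ?_⟩
  have hlim : Tendsto (fun A : ℝ => ENNReal.ofReal (M / (2 * (v : ℝ)) - A ^ 2 / (v : ℝ) ^ 2))
      (𝓝[>] 0) (𝓝 (ENNReal.ofReal (M / (2 * (v : ℝ))))) := by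
    refine ENNReal.tendsto_ofReal (tendsto_nhdsWithin_of_tendsto_nhds ?_)
    have hcont : Continuous fun A : ℝ => M / (2 * (v : ℝ)) - A ^ 2 / (v : ℝ) ^ 2 := by fun_prop
    simpa using hcont.tendsto 0
  have hsmall : ∀ᶠ A : ℝ in 𝓝[>] 0, 0 < A ∧ A ^ 2 ≤ v := by
    refine eventually_mem_nhdsWithin.and (nhdsWithin_le_nhds ?_)
    have hcont : Continuous fun A : ℝ => A ^ 2 := by fun_prop
    exact (hcont.tendsto 0).eventually_le_const (by simpa using hv)
  refine tendsto_of_tendsto_of_tendsto_of_le_of_le' hlim tendsto_const_nhds ?_ ?_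
  · filter_upwards [hsmall] with A hA
    have hpos : 0 < A ^ 2 := pow_pos hA.1 2
    rw [ENNReal.le_div_iff_mul_le (Or.inl (by simpa using hA.1.ne'))
      (Or.inl ENNReal.ofReal_ne_top)]
    exact GaussianChannel.le_capacity hv.ne' hA.1 hA.2 hM.1
  · filter_upwards [hsmall] with A hA
    exact ENNReal.div_le_of_le_mul (GaussianChannel.capacity_le hv.ne' hA.1 hA.2 hM.2)
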